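/- A line arrangement $\mathcal A$ is a finite set of distinct lines in the complex projective plane $\mathbb P^2$, and $d=|\mathcal A|$ is its number of lines. The multiplicity of a point is the number of lines of $\mathcal A$ passing through it; an intersection point is a point of multiplicity at least $2$, and $n_2$ is the number of intersection points of multiplicity exactly $2$. $\mathcal A$ is a pencil if all its lines pass through one common point. Let $S=\mathbb C[x,y,z]$ and, for each line $H\in\mathcal A$, let $\alpha_H$ be a linear form defining $H$. $\mathcal A$ is free if the graded $S$-module $$D(\mathcal A)=\{\theta\in \mathrm{Der}_{\mathbb C}(S) : \theta(\alpha_H)\in S\alpha_H \text{ for all } H\in\mathcal A\}$$ is isomorphic to $S[-1]\oplus S[-d_2]\oplus S[-d_3]$ for some integers $d_2,d_3\ge 0$, where a derivation has degree $k$ if its values on $x,y,z$ are homogeneous of degree $k$. A modular point is an intersection point $p$ such that for every other intersection point $q$ the line $\overline{pq}$ belongs to $\mathcal A$. $\mathcal A$ is $m$-homogeneous supersolvable if it has a modular point and all its modular points have multiplicity $m$. **Theorem.** Let $\mathcal A$ be a free line arrangement of $d$ lines which is not a pencil, and let $m$ be the maximal multiplicity of an intersection point of $\mathcal A$. If $2m\ge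 d$, then $$n_2\ \ge\ -2m^2+(3d-1)m-d^2+d\ \ge\ \frac d2 .$$ In particular, if $\mathcal A$ is an $m$-homogeneous supersolvable line arrangement of $d$ lines which is not a pencil and $2m\ge d$, then $n_2\ge \frac d2$ (that is, the Anzis–Tohăneanu conjecture, which asserts $n_2\ge d/2$ for every supersolvable line arrangement of $d$ lines that is not a pencil, holds for $\mathcal A$). -/

import Mathlib

open scoped LinearAlgebra.Projectivization

/-- Points of the complex projective plane. -/
abbrev ProjPoint := ℙ ℂ (Fin 3 → ℂ)

/-- Lines of the complex projective plane, as points of the dual plane: `(a : b : c)` is the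
line `a x + b y + c z = 0`. Distinct points of the dual plane give distinct lines. -/
abbrev ProjLine := ℙ ℂ (Fin 3 → ℂ)

/-- The point `p` lies on the line `L`, i.e. `a x + b y + c z = 0` for `p = (x : y : z)` and
`L = (a : b : c)`. -/
def LiesOn (p : ProjPoint) (L : ProjLine) : Prop := p.orthogonal L

/-- A line arrangement in the complex projective plane: a finite set of lines. -/
abbrev LineArrangement := Finset ProjLine

/-- The polynomial ring `S = ℂ[x, y, z]`. -/
abbrev PolyS := MvPolynomial (Fin 3) ℂ

/-- A linear form `a x + b y + c z` (unique up to a nonzero constant) defining the line. -/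
noncomputable def ProjLine.form (L : ProjLine) : PolyS :=
  ∑ i, MvPolynomial.C (L.rep i) * MvPolynomial.X i

/-- A derivation of `S` is homogeneous of degree `k` if its three coefficients
`θ x`, `θ y`, `θ z` are homogeneous polynomials of degree `k`. -/
def DerivIsHomogeneous (θ : Derivation ℂ PolyS PolyS) (k : ℕ) : Prop :=
  ∀ i, (θ (MvPolynomial.X i)).IsHomogeneous k

namespace LineArrangement

open Classical in
/-- The lines of the arrangement that pass through `p`. -/
noncomputable def linesThrough (A : LineArrangement) (p : ProjPoint) : Finset ProjLine :=
  A.filter (fun L => LiesOn p L)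

/-- The multiplicity of `p` in the arrangement: the number of its lines through `p`. -/
noncomputable def mult (A : LineArrangement) (p : ProjPoint) : ℕ := (A.linesThrough p).card

/-- An intersection point lies on at least two lines of the arrangement. -/
def IsIntersectionPoint (A : LineArrangement) (p : ProjPoint) : Prop := 2 ≤ A.mult p

/-- The number `n_k` of intersection points of multiplicity `k` (for `k ≥ 2`); the set that is
counted is finite, because two distinct lines meet in one point. -/
noncomputable def numPoints (A : LineArrangement) (k : ℕ) : ℕ :=
  Set.ncard {p : ProjPoint | A.IsIntersectionPoint p ∧ A.mult p = k}

/-- `m` is the maximal multiplicity of an intersection point of the arrangement. -/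
def IsMaxMult (A : LineArrangement) (m : ℕ) : Prop :=
  IsGreatest {k : ℕ | ∃ p : ProjPoint, A.IsIntersectionPoint p ∧ A.mult p = k} m

/-- All lines of the arrangement pass through one point. -/
def IsPencil (A : LineArrangement) : Prop := ∃ p : ProjPoint, ∀ L ∈ A, LiesOn p L

/-- A modular point: an intersection point `p` such that for any other intersection point `q`
the line joining `p` and `q` belongs to the arrangement. -/
def IsModular (A : LineArrangement) (p : ProjPoint) : Prop :=
  A.IsIntersectionPoint p ∧
    ∀ q : ProjPoint, A.IsIntersectionPoint q → q ≠ p → ∃ L ∈ A, LiesOn p L ∧ LiesOn q L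

/-- The arrangement has a modular point. -/
def IsSupersolvable (A : LineArrangement) : Prop := ∃ p : ProjPoint, A.IsModular p

/-- Supersolvable, and all modular points have the same multiplicity `m`. -/
def IsHomogeneousSupersolvable (A : LineArrangement) (m : ℕ) : Prop :=
  A.IsSupersolvable ∧ ∀ p : ProjPoint, A.IsModular p → A.mult p = m

/-- The logarithmic derivation module `D(A)`: the derivations `θ` of `S` such that
`θ α ∈ S α` for every line `α = 0` of the arrangement. -/
noncomputable def logDer (A : LineArrangement) :
    Submodule PolyS (Derivation ℂ PolyS PolyS) where
  carrier := {θ | ∀ L ∈ A, θ (ProjLine.form L) ∈ Ideal.span {ProjLine.form L}}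
  add_mem' := fun {_ _} hθ hη L hL => Ideal.add_mem _ (hθ L hL) (hη L hL)
  zero_mem' := fun _ _ => Ideal.zero_mem _
  smul_mem' := fun c _ hθ L hL => Ideal.mul_mem_left _ c (hθ L hL)

/-- `D(A) ≅ S[-1] ⊕ S[-d₂] ⊕ S[-d₃]` as a graded `S`-module, i.e. `D(A)` has an `S`-basis of
homogeneous derivations of degrees `1`, `d₂`, `d₃`. -/
def IsFreeWithExponents (A : LineArrangement) (d₂ d₃ : ℕ) : Prop :=
  ∃ b : Module.Basis (Fin 3) PolyS A.logDer,
    ∀ i, DerivIsHomogeneous (b i : Derivation ℂ PolyS PolyS) (![1, d₂, d₃] i)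

/-- A free line arrangement. -/
def IsFree (A : LineArrangement) : Prop := ∃ d₂ d₃ : ℕ, A.IsFreeWithExponents d₂ d₃

end LineArrangement

/-! The bound is a count of double points around a single point `p` of multiplicity `m`, and it
factors as `(d - m) (2m + 1 - d)`. Each of the `d - m` lines `L` avoiding `p` meets the `m` lines
through `p` in `m` distinct points. The other `d - m - 1` lines avoiding `p` spoil at most one of
these points each, so at least `2m + 1 - d` of them are double
(`mult_le_card_simpleTransversals_add`, `mult_meet_eq_two`). Different lines `L` yield different
double points (`sum_card_simpleTransversals_le_numPoints`). The comparison with `d / 2` is then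
arithmetic, using `m < d` (not a pencil) and `d ≤ 2m`. -/

/-- Two points on two distinct lines coincide. -/
theorem LiesOn.eq_of_ne {p q : ProjPoint} {L M : ProjLine} (hLM : L ≠ M)
    (hpL : LiesOn p L) (hpM : LiesOn p M) (hqL : LiesOn q L) (hqM : LiesOn q M) : p = q :=
  (Configuration.ofField.eq_or_eq_of_orthogonal hpL hqL hpM hqM).resolve_right hLM

open Classical in
/-- The intersection point of two lines (a junk value if the lines coincide). -/
noncomputable def ProjLine.meet (L M : ProjLine) : ProjPoint := Projectivization.cross L M

theorem ProjLine.meet_left {L M : ProjLine} (h : L ≠ M) : LiesOn (L.meet M) L := by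
  classical
  exact Projectivization.cross_orthogonal_left h

theorem ProjLine.meet_right {L M : ProjLine} (h : L ≠ M) : LiesOn (L.meet M) M := by
  classical
  exact Projectivization.cross_orthogonal_right h

namespace LineArrangement

theorem mem_linesThrough {A : LineArrangement} {p : ProjPoint} {L : ProjLine} :
    L ∈ A.linesThrough p ↔ L ∈ A ∧ LiesOn p L := by
  simp [linesThrough]

theorem linesThrough_subset (A : LineArrangement) (p : ProjPoint) : A.linesThrough p ⊆ A :=
  fun _ hL => (mem_linesThrough.1 hL).1

theorem finite_setOf_isIntersectionPoint (A : LineArrangement) :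
    {p : ProjPoint | A.IsIntersectionPoint p}.Finite := by
  classical
  refine ((A ×ˢ A).image fun x => x.1.meet x.2).finite_toSet.subset fun p hp => ?_
  obtain ⟨L, hL, M, hM, hLM⟩ := Finset.one_lt_card.1 (show 1 < (A.linesThrough p).card from hp)
  rw [mem_linesThrough] at hL hM
  refine Finset.mem_coe.2 (Finset.mem_image.2
    ⟨(L, M), Finset.mem_product.2 ⟨hL.1, hM.1⟩, ?_⟩)
  exact LiesOn.eq_of_ne hLM (ProjLine.meet_left hLM) (ProjLine.meet_right hLM) hL.2 hM.2

open Classical in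
/-- The lines of `A` that do not pass through `p`. -/
noncomputable def linesAvoiding (A : LineArrangement) (p : ProjPoint) : Finset ProjLine :=
  A \ A.linesThrough p

theorem mem_linesAvoiding {A : LineArrangement} {p : ProjPoint} {L : ProjLine} :
    L ∈ A.linesAvoiding p ↔ L ∈ A ∧ ¬ LiesOn p L := by
  classical
  rw [linesAvoiding, Finset.mem_sdiff, mem_linesThrough]
  tauto

theorem card_linesAvoiding_add_mult (A : LineArrangement) (p : ProjPoint) :
    (A.linesAvoiding p).card + A.mult p = A.card := by
  classical
  exact Finset.card_sdiff_add_card_eq_card (A.linesThrough_subset p)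

theorem mult_lt_card_of_not_isPencil {A : LineArrangement} (h : ¬ A.IsPencil) (p : ProjPoint) :
    A.mult p < A.card := by
  refine Finset.card_lt_card ((A.linesThrough_subset p).ssubset_of_ne fun heq => h ⟨p, fun L hL => ?_⟩)
  rw [← heq] at hL
  exact (mem_linesThrough.1 hL).2

open Classical in
/-- The lines `H` of `A` through `p` that meet `L` in a point lying on no other line of `A`
avoiding `p`. -/
noncomputable def simpleTransversals (A : LineArrangement) (p : ProjPoint) (L : ProjLine) :
    Finset ProjLine :=
  (A.linesThrough p).filter
    fun H => ∀ M ∈ A.linesAvoiding p, LiesOn (L.meet H) M → M = L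

theorem mem_simpleTransversals {A : LineArrangement} {p : ProjPoint} {L H : ProjLine} :
    H ∈ A.simpleTransversals p L ↔ (H ∈ A ∧ LiesOn p H) ∧
      ∀ M ∈ A.linesAvoiding p, LiesOn (L.meet H) M → M = L := by
  classical
  rw [simpleTransversals, Finset.mem_filter, mem_linesThrough]

/-- Two lines through `p` meeting a line `L` that avoids `p` in the same point are equal. -/
theorem eq_of_meet_eq {p : ProjPoint} {L H K : ProjLine} (hL : ¬ LiesOn p L)
    (hH : LiesOn p H) (hK : LiesOn p K) (h : L.meet H = L.meet K) : H = K := by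
  have hLH : L ≠ H := by rintro rfl; exact hL hH
  have hLK : L ≠ K := by rintro rfl; exact hL hK
  by_contra hHK
  have hp : p = L.meet H := LiesOn.eq_of_ne hHK hH hK (ProjLine.meet_right hLH)
    (h ▸ ProjLine.meet_right hLK)
  exact hL (hp ▸ ProjLine.meet_left hLH)

/-- A line through `p` that is not a simple transversal is charged to a line `M ≠ L` avoiding `p`
through its intersection with `L`. The `+ 1` accounts for `L` itself, which is not available as `M`.
-/
theorem mult_le_card_simpleTransversals_add {A : LineArrangement} {p : ProjPoint} {L : ProjLine}
    (hL : L ∈ A.linesAvoiding p) :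
    A.mult p + 1 ≤ (A.simpleTransversals p L).card + (A.linesAvoiding p).card := by
  classical
  have hLp := (mem_linesAvoiding.1 hL).2
  have hbad : ∀ H ∈ A.linesThrough p \ A.simpleTransversals p L,
      ∃ M ∈ (A.linesAvoiding p).erase L, LiesOn (L.meet H) M := by
    intro H hH
    rw [Finset.mem_sdiff, mem_simpleTransversals, mem_linesThrough] at hH
    have hnot := hH.2
    push Not at hnot
    obtain ⟨M, hM, hMH, hML⟩ := hnot hH.1
    exact ⟨M, Finset.mem_erase.2 ⟨hML, hM⟩, hMH⟩
  choose! f hf hfH using hbad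
  -- The charging is injective: `M` meets `L` in only one point, and that point lies on only one
  -- line through `p`.
  have hcard := Finset.card_le_card_of_injOn f hf (by
    intro H hH K hK hHK
    have hHp := (mem_linesThrough.1 (Finset.mem_sdiff.1 hH).1).2
    have hKp := (mem_linesThrough.1 (Finset.mem_sdiff.1 hK).1).2
    refine eq_of_meet_eq hLp hHp hKp (LiesOn.eq_of_ne (Finset.ne_of_mem_erase (hf H hH)).symm
      (ProjLine.meet_left ?_) (hfH H hH) (ProjLine.meet_left ?_) (hHK ▸ hfH K hK))
    · rintro rfl; exact hLp hHp
    · rintro rfl; exact hLp hKp)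
  have hsub : A.simpleTransversals p L ⊆ A.linesThrough p := Finset.filter_subset _ _
  have h1 := Finset.card_sdiff_add_card_eq_card hsub
  have h2 := Finset.card_erase_add_one hL
  unfold mult
  omega

/-- The point where a simple transversal meets its line is a double point. -/
theorem mult_meet_eq_two {A : LineArrangement} {p : ProjPoint} {L H : ProjLine}
    (hL : L ∈ A.linesAvoiding p) (hH : H ∈ A.simpleTransversals p L) :
    A.mult (L.meet H) = 2 := by
  classical
  rw [mem_simpleTransversals] at hH
  obtain ⟨⟨hHA, hHp⟩, huniq⟩ := hH
  obtain ⟨hLA, hLp⟩ := mem_linesAvoiding.1 hL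
  have hLH : L ≠ H := by rintro rfl; exact hLp hHp
  rw [mult, show A.linesThrough (L.meet H) = {L, H} from ?_, Finset.card_pair hLH]
  ext M
  rw [mem_linesThrough, Finset.mem_insert, Finset.mem_singleton]
  constructor
  · rintro ⟨hMA, hM⟩
    by_cases hMp : LiesOn p M
    · right
      -- Otherwise `M` and `H` meet only at `p`, which would then lie on `L`.
      by_contra hMH
      have hp := LiesOn.eq_of_ne hMH hMp hHp hM (ProjLine.meet_right hLH)
      exact hLp (hp ▸ ProjLine.meet_left hLH)
    · exact Or.inl (huniq M (mem_linesAvoiding.2 ⟨hMA, hMp⟩) hM)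
  · rintro (rfl | rfl)
    · exact ⟨hLA, ProjLine.meet_left hLH⟩
    · exact ⟨hHA, ProjLine.meet_right hLH⟩

/-- The pair `(L, H)` can be recovered from its double point: `L` is the only line avoiding `p`
through that point, and `H` is then determined. -/
theorem sum_card_simpleTransversals_le_numPoints (A : LineArrangement) (p : ProjPoint) :
    ∑ L ∈ A.linesAvoiding p, (A.simpleTransversals p L).card ≤ A.numPoints 2 := by
  classical
  rw [← Finset.card_sigma, numPoints, ← Set.ncard_coe_finset]
  refine Set.ncard_le_ncard_of_injOn (fun x => x.1.meet x.2) ?_ ?_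
    (A.finite_setOf_isIntersectionPoint.subset fun _ h => h.1)
  · rintro ⟨L, H⟩ hx
    obtain ⟨hL, hH⟩ := Finset.mem_sigma.1 (Finset.mem_coe.1 hx)
    have h := mult_meet_eq_two hL hH
    exact ⟨h.ge, h⟩
  · rintro ⟨L, H⟩ hx ⟨M, K⟩ hy hxy
    obtain ⟨hL, hH⟩ := Finset.mem_sigma.1 (Finset.mem_coe.1 hx)
    obtain ⟨hM, hK⟩ := Finset.mem_sigma.1 (Finset.mem_coe.1 hy)
    dsimp only at hL hH hM hK hxy
    rw [mem_simpleTransversals] at hH hK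
    have hMK : M ≠ K := by
      rintro rfl; exact (mem_linesAvoiding.1 hM).2 hK.1.2
    obtain rfl : M = L := hH.2 M hM (hxy ▸ ProjLine.meet_left hMK)
    obtain rfl : H = K := eq_of_meet_eq (mem_linesAvoiding.1 hL).2 hH.1.2 hK.1.2 hxy
    rfl

/-- A point of multiplicity `m` in an arrangement of `d` lines forces at least
`(d - m) (2 m + 1 - d)` double points. -/
theorem card_linesAvoiding_mul_le_numPoints (A : LineArrangement) (p : ProjPoint) :
    (A.card - A.mult p) * (2 * A.mult p + 1 - A.card) ≤ A.numPoints 2 := by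
  have hcard := A.card_linesAvoiding_add_mult p
  refine le_trans ?_ (A.sum_card_simpleTransversals_le_numPoints p)
  rw [show A.card - A.mult p = (A.linesAvoiding p).card by omega, ← smul_eq_mul]
  -- When `2m + 1 < d` the second factor truncates to `0`, so the termwise bound still holds.
  refine Finset.card_nsmul_le_sum _ _ _ fun L hL => ?_
  have := mult_le_card_simpleTransversals_add hL
  omega

theorem doublePoint_bounds {A : LineArrangement} (hA : ¬ A.IsPencil) {p : ProjPoint}
    (hp : A.card ≤ 2 * A.mult p) :
    (A.numPoints 2 : ℝ) ≥ -2 * (A.mult p : ℝ) ^ 2 + (3 * (A.card : ℝ) - 1) * A.mult p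
        - (A.card : ℝ) ^ 2 + A.card ∧
      -2 * (A.mult p : ℝ) ^ 2 + (3 * (A.card : ℝ) - 1) * A.mult p
        - (A.card : ℝ) ^ 2 + A.card ≥ (A.card : ℝ) / 2 := by
  have hlt := mult_lt_card_of_not_isPencil hA p
  have hbound := A.card_linesAvoiding_mul_le_numPoints p
  generalize A.card = d at *
  generalize A.mult p = m at *
  -- With `k = d - m - 1` and `l = 2m - d`, natural-number subtraction disappears and the bound
  -- becomes `(k + 1) (l + 1)`.
  obtain ⟨k, rfl⟩ := Nat.exists_eq_add_of_lt hlt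
  obtain ⟨l, rfl⟩ := Nat.exists_eq_add_of_le (show k + 1 ≤ m by omega)
  rw [show k + 1 + l + k + 1 - (k + 1 + l) = k + 1 by omega,
    show 2 * (k + 1 + l) + 1 - (k + 1 + l + k + 1) = l + 1 by omega] at hbound
  have hbound' : ((k : ℝ) + 1) * (l + 1) ≤ A.numPoints 2 := by exact_mod_cast hbound
  have hk : (0 : ℝ) ≤ k := k.cast_nonneg
  have hl : (0 : ℝ) ≤ l := l.cast_nonneg
  push_cast
  -- Since `d / 2 = k + 1 + l / 2`, the second inequality has slack `k l + l / 2`.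
  constructor <;> nlinarith [mul_nonneg hk hl]

end LineArrangement

theorem theorem1p6 (A : LineArrangement) (d m : ℕ) (hd : A.card = d)
    (hpencil : ¬ A.IsPencil) (hmd : d ≤ 2 * m) :
    (A.IsFree → A.IsMaxMult m →
      (A.numPoints 2 : ℝ) ≥ -2 * (m : ℝ) ^ 2 + (3 * (d : ℝ) - 1) * m - (d : ℝ) ^ 2 + d ∧
      -2 * (m : ℝ) ^ 2 + (3 * (d : ℝ) - 1) * m - (d : ℝ) ^ 2 + d ≥ (d : ℝ) / 2) ∧
    (A.IsHomogeneousSupersolvable m → (A.numPoints 2 : ℝ) ≥ (d : ℝ) / 2) := by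
  subst hd
  constructor
  · rintro - ⟨⟨p, -, rfl⟩, -⟩
    exact LineArrangement.doublePoint_bounds hpencil hmd
  -- The count works around any point with `d ≤ 2 * A.mult p`, so a modular point can serve as the
  -- centre.
  · rintro ⟨⟨p, hp⟩, hm⟩
    obtain rfl := hm p hp
    have h := LineArrangement.doublePoint_bounds hpencil hmd
    exact h.2.trans h.1
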